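/- Let $(M,g)$ be a (finite- or infinite-dimensional) Riemannian manifold, i.e. a $C^\infty$ manifold modelled on a real Hilbert space $H$ with inner products $g_p$ on the tangent spaces $TM_p$ that depend $C^\infty$-smoothly on $p$ and whose norms $\|\cdot\|_p$ define the topology of $TM_p$. For $f:M\to\mathbb{R}$ and $p\in M$ let $D^-f(p)\subset T^*M_p$ (resp. $D^+f(p)$) be the set of all derivatives $d\varphi(p)$ of $C^1$ functions $\varphi:M\to\mathbb{R}$ such that $f-\varphi$ attains a local minimum (resp. a local maximum) at $p$, and for $\zeta\in T^*M_p$ let $\|\zeta\|_p$ be its dual norm with respect to $\|\cdot\|_p$. **Theorem (Godefroy's mean value inequality).** Let $f:M\to\mathbb{R}$ be a Borel function such that $D^-f(p)\cup D^+f(p)\neq\emptyset$ for every $p\in M$, and define $\Phi:M\to\mathbb{R}$ by $$\Phi(p)=\inf\{\|\zeta\|_p:\zeta\in D^-f(p)\cup D^+f(p)\}.$$ Then for every interval $I\subset\mathbb{R}$ and every continuous, piecewise $C^1$ path $\gamma:I\to M$ parameterized by arc length (there is a set of break points, finite in each compact subinterval of $I$, such that $\gamma$ is $C^1$ with $\|\gamma'(t)\|_{\gamma(t)}=1$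 on each compact subinterval of $I$ without break points in its interior), one has $$\mu\big(f(\gamma(I))\big)\le\int_I\Phi(\gamma(t))\,dt .$$ Here $\mu$ is Lebesgue (outer) measure on $\mathbb{R}$, and the integral, which may be $+\infty$, is the Lebesgue integral of the nonnegative function $\Phi\circ\gamma$ (the lower integral, i.e. the supremum of the integrals of the measurable functions between $0$ and $\Phi\circ\gamma$, in case $\Phi\circ\gamma$ is not measurable). -/

import Mathlib

open Set MeasureTheory Bundle
open scoped Manifold ContDiff Topology ENNReal

noncomputable section

/-- The viscosity subdifferential `D⁻f(p) ⊆ T*M_p`: all the derivatives `dφ(p)` of `C¹` functions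
`φ : M → ℝ` such that `f - φ` attains a local minimum at `p`. -/
def viscositySubdifferential {H : Type*} [NormedAddCommGroup H] [InnerProductSpace ℝ H]
    {M : Type*} [TopologicalSpace M] [ChartedSpace H M] (f : M → ℝ) (p : M) :
    Set (TangentSpace 𝓘(ℝ, H) p →L[ℝ] ℝ) :=
  {ζ | ∃ φ : M → ℝ, ContMDiff 𝓘(ℝ, H) 𝓘(ℝ, ℝ) 1 φ ∧
    IsLocalMin (fun x => f x - φ x) p ∧ ζ = mfderiv 𝓘(ℝ, H) 𝓘(ℝ, ℝ) φ p}

/-- The viscosity superdifferential `D⁺f(p) ⊆ T*M_p`: all the derivatives `dφ(p)` of `C¹` functions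
`φ : M → ℝ` such that `f - φ` attains a local maximum at `p`. -/
def viscositySuperdifferential {H : Type*} [NormedAddCommGroup H] [InnerProductSpace ℝ H]
    {M : Type*} [TopologicalSpace M] [ChartedSpace H M] (f : M → ℝ) (p : M) :
    Set (TangentSpace 𝓘(ℝ, H) p →L[ℝ] ℝ) :=
  {ζ | ∃ φ : M → ℝ, ContMDiff 𝓘(ℝ, H) 𝓘(ℝ, ℝ) 1 φ ∧
    IsLocalMax (fun x => f x - φ x) p ∧ ζ = mfderiv 𝓘(ℝ, H) 𝓘(ℝ, ℝ) φ p}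

/-- `Φ(p) = inf {‖ζ‖_p : ζ ∈ D⁻f(p) ∪ D⁺f(p)}`, where `‖·‖_p` is the dual (operator) norm of the
norm that the Riemannian metric puts on the tangent space at `p`. -/
def minSubgradientNorm {H : Type*} [NormedAddCommGroup H] [InnerProductSpace ℝ H]
    {M : Type*} [TopologicalSpace M] [ChartedSpace H M] [IsManifold 𝓘(ℝ, H) ∞ M]
    [RiemannianBundle (fun x : M => TangentSpace 𝓘(ℝ, H) x)] (f : M → ℝ) (p : M) : ℝ :=
  sInf ((fun ζ : TangentSpace 𝓘(ℝ, H) p →L[ℝ] ℝ => ‖ζ‖) ''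
    (viscositySubdifferential f p ∪ viscositySuperdifferential f p))

/-- `γ` restricted to the interval `J` is a piecewise `C¹` path parameterized by arc length.
The set `S` of break points is finite in each compact subinterval of `J`; on every compact
subinterval `[c, d]` with no break point in its interior, `γ` is `C¹` (up to the end points) and
its velocity (one-sided at the end points) has norm one. -/
structure IsArcLengthPath (H : Type*) [NormedAddCommGroup H] [InnerProductSpace ℝ H]
    {M : Type*} [TopologicalSpace M] [ChartedSpace H M] [IsManifold 𝓘(ℝ, H) ∞ M]
    [RiemannianBundle (fun x : M => TangentSpace 𝓘(ℝ, H) x)] (γ : ℝ → M) (J : Set ℝ) :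
    Prop where
  continuousOn : ContinuousOn γ J
  piecewise : ∃ S : Set ℝ,
    (∀ c ∈ J, ∀ d ∈ J, (S ∩ Icc c d).Finite) ∧
    ∀ c ∈ J, ∀ d ∈ J, c < d → Disjoint S (Ioo c d) →
      ContMDiffOn 𝓘(ℝ, ℝ) 𝓘(ℝ, H) 1 γ (Icc c d) ∧
      ∀ t ∈ Icc c d,
        ‖(mfderivWithin 𝓘(ℝ, ℝ) 𝓘(ℝ, H) γ (Icc c d) t (1 : ℝ) :
          TangentSpace 𝓘(ℝ, H) (γ t))‖ = 1

end

/-!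
Put `g = f ∘ γ` and `h = Φ ∘ γ`. Off the countably many break points and end points, the chain rule
along `γ` (whose velocity has norm one) turns a sub- or superdifferential of `f` at `γ t` of norm
less than `c` into a cone condition on the line: near `t`, either `g s ≥ g t - c * |s - t|` or `g s
≤ g t + c * |s - t|` (`mem_coneSet_of_minSubgradientNorm_lt`).

Two observations on the set where the first condition holds for all `s` within a fixed distance `r`
of `t` carry the proof. Any two points of it at distance less than `r` can be compared in both
directions, so `g` is locally `c`-Lipschitz on it and multiplies outer measure by at most `c`. It is
moreover Borel (`measurableSet_lowerConeSet`), because the condition on `t` reads `g t ≤ inf (g s +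
c * |s - t|)` over `|s - t| < r`, with a right-hand side that is upper semicontinuous in `t`
whatever `g` is. The same holds for the second condition, by passing to `-g`.

Hence the sets of points where a cone condition of slope `k * ε` holds for some radius are
measurable and increase with `k`. At the points that enter with slope `(k + 1) * ε` but not with
slope `k * ε` one has `k * ε ≤ h`, while `g` expands measure there by at most `(k + 1) * ε`; summing
over `k` and letting `ε` tend to zero on pieces of finite length gives the inequality. No
measurability of `h` enters, since the comparison with `h` is through functions constant on
measurable pieces.
-/

/-! ### Mean value inequality on the line -/

/-- The points `t ∈ J` at which `g` is bounded from below, on the part of `J` at distance less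
than `r`, by the downward cone of slope `c` with vertex `(t, g t)`. -/
def lowerConeSet (g : ℝ → ℝ) (J : Set ℝ) (c r : ℝ) : Set ℝ :=
  {t ∈ J | ∀ s ∈ J, |s - t| < r → g t - c * |s - t| ≤ g s}

/-- The points of `J` at which `g` stays, near the point and on `J`, above a downward cone of
slope `c` or below an upward cone of slope `c`; the radii are restricted to a sequence. -/
def coneSet (g : ℝ → ℝ) (J : Set ℝ) (c : ℝ) : Set ℝ :=
  (⋃ n : ℕ, lowerConeSet g J c (1 / (n + 1))) ∪
    ⋃ n : ℕ, lowerConeSet (fun t => -g t) J c (1 / (n + 1))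

/-- The complement of a cone set in `J` is a countable union of sets of the form `U ∩ {q < g}` with
`U` open, since `t ↦ g s + c * |s - t|` is continuous. -/
lemma measurableSet_lowerConeSet {g : ℝ → ℝ} {J : Set ℝ} (hJ : MeasurableSet J)
    (hg : Measurable (J.domRestrict g)) (c r : ℝ) : MeasurableSet (lowerConeSet g J c r) := by
  have hU (q : ℚ) : IsOpen (⋃ s ∈ J, {t : ℝ | |s - t| < r ∧ g s + c * |s - t| < q}) := by
    refine isOpen_biUnion fun s _ => IsOpen.inter ?_ ?_
    · exact isOpen_lt (f := fun t : ℝ => |s - t|) (by fun_prop) continuous_const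
    · exact isOpen_lt (f := fun t : ℝ => g s + c * |s - t|) (by fun_prop) continuous_const
  have hV (q : ℚ) : MeasurableSet {t ∈ J | (q : ℝ) < g t} := by
    have := hJ.subtype_image (hg (measurableSet_Ioi (a := (q : ℝ))))
    convert this using 1
    ext t
    simp [Set.domRestrict, and_comm]
  have : lowerConeSet g J c r = J \ ⋃ q : ℚ,
      (⋃ s ∈ J, {t : ℝ | |s - t| < r ∧ g s + c * |s - t| < q}) ∩ {t ∈ J | (q : ℝ) < g t} := by
    ext t
    simp only [lowerConeSet, mem_ofPred_eq, mem_sdiff, mem_iUnion, mem_inter_iff, not_exists]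
    refine and_congr_right fun ht => ⟨?_, ?_⟩
    · rintro h q ⟨⟨s, hs, hsr, hsq⟩, -, hq⟩
      linarith [h s hs hsr]
    · intro h s hs hsr
      by_contra! hlt
      obtain ⟨q, hq1, hq2⟩ := exists_rat_btwn (show g s + c * |s - t| < g t by linarith)
      exact h q ⟨⟨s, hs, hsr, hq1⟩, ht, hq2⟩
  rw [this]
  exact hJ.diff (MeasurableSet.iUnion fun q => (hU q).measurableSet.inter (hV q))

lemma measurableSet_coneSet {g : ℝ → ℝ} {J : Set ℝ} (hJ : MeasurableSet J)
    (hg : Measurable (J.domRestrict g)) (c : ℝ) : MeasurableSet (coneSet g J c) :=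
  (MeasurableSet.iUnion fun _ => measurableSet_lowerConeSet hJ hg c _).union
    (MeasurableSet.iUnion fun _ => measurableSet_lowerConeSet (g := fun t => -g t) hJ hg.neg c _)

lemma volume_image_le_of_lipschitz_of_dist_lt {g : ℝ → ℝ} {E : Set ℝ} (hE : MeasurableSet E)
    {c r : ℝ} (hr : 0 < r)
    (h : ∀ x ∈ E, ∀ y ∈ E, |x - y| < r → |g x - g y| ≤ c * |x - y|) :
    volume (g '' E) ≤ ENNReal.ofReal c * volume E := by
  let P : ℤ → Set ℝ := fun m => E ∩ {t | ⌊t / r⌋ = m}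
  have hPm (m : ℤ) : MeasurableSet (P m) :=
    hE.inter ((Int.measurable_floor.comp (measurable_id.div_const r)) (measurableSet_singleton m))
  have hPE : ⋃ m, P m = E := by ext t; simp [P]
  have hPd : Pairwise (Function.onFun Disjoint P) := by
    intro i j hij
    exact Set.disjoint_left.2 fun t hi hj => hij (hi.2.symm.trans hj.2)
  have hP (m : ℤ) : volume (g '' P m) ≤ ENNReal.ofReal c * volume (P m) := by
    have hlip : LipschitzOnWith c.toNNReal g (P m) := by
      refine LipschitzOnWith.of_dist_le_mul fun x hx y hy => ?_
      have h1 := Int.abs_sub_lt_one_of_floor_eq_floor (hx.2.trans hy.2.symm)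
      rw [← sub_div, abs_div, abs_of_pos hr, div_lt_one hr] at h1
      rw [Real.dist_eq, Real.dist_eq]
      exact (h x hx.1 y hy.1 h1).trans
        (mul_le_mul_of_nonneg_right (Real.le_coe_toNNReal c) (abs_nonneg _))
    have := hlip.hausdorffMeasure_image_le (d := 1) zero_le_one
    simpa [hausdorffMeasure_real, ENNReal.ofReal] using this
  calc volume (g '' E) = volume (⋃ m, g '' P m) := by rw [← image_iUnion, hPE]
    _ ≤ ∑' m, volume (g '' P m) := measure_iUnion_le _
    _ ≤ ∑' m, ENNReal.ofReal c * volume (P m) := ENNReal.tsum_le_tsum hP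
    _ = ENNReal.ofReal c * volume E := by
      rw [ENNReal.tsum_mul_left, ← measure_iUnion hPd hPm, hPE]

/-- Any two nearby points of a cone set lie in each other's cone, so `g` is Lipschitz there. -/
lemma abs_sub_le_of_mem_lowerConeSet {g : ℝ → ℝ} {J : Set ℝ} {c r x y : ℝ}
    (hx : x ∈ lowerConeSet g J c r) (hy : y ∈ lowerConeSet g J c r) (hxy : |x - y| < r) :
    |g x - g y| ≤ c * |x - y| := by
  have h1 := hy.2 x hx.1 hxy
  have h2 := hx.2 y hy.1 (by rwa [abs_sub_comm])
  rw [abs_sub_comm y x] at h2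
  exact abs_sub_le_iff.2 ⟨by linarith, by linarith⟩

lemma volume_image_le_of_subset_iUnion {g : ℝ → ℝ} {E : Set ℝ} (hE : MeasurableSet E)
    {B : ℕ → Set ℝ} (hB : ∀ n, MeasurableSet (B n)) (hEB : E ⊆ ⋃ n, B n) {C : ℝ≥0∞}
    (h : ∀ n, ∀ F ⊆ B n, MeasurableSet F → volume (g '' F) ≤ C * volume F) :
    volume (g '' E) ≤ C * volume E := by
  have hm (n : ℕ) : MeasurableSet (E ∩ disjointed B n) := hE.inter (.disjointed hB n)
  have hU : ⋃ n, E ∩ disjointed B n = E := by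
    rw [← inter_iUnion, iUnion_disjointed, inter_eq_left.2 hEB]
  have hd : Pairwise (Function.onFun Disjoint fun n => E ∩ disjointed B n) := fun i j hij =>
    (disjoint_disjointed B hij).mono inter_subset_right inter_subset_right
  calc volume (g '' E) = volume (⋃ n, g '' (E ∩ disjointed B n)) := by rw [← image_iUnion, hU]
    _ ≤ ∑' n, volume (g '' (E ∩ disjointed B n)) := measure_iUnion_le _
    _ ≤ ∑' n, C * volume (E ∩ disjointed B n) := ENNReal.tsum_le_tsum fun n =>
      h n _ (inter_subset_right.trans (disjointed_subset B n)) (hm n)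
    _ = C * volume E := by rw [ENNReal.tsum_mul_left, ← measure_iUnion hd hm, hU]

lemma volume_image_le_of_subset_coneSet {g : ℝ → ℝ} {J : Set ℝ} (hJ : MeasurableSet J)
    (hg : Measurable (J.domRestrict g)) {c : ℝ} {E : Set ℝ} (hE : MeasurableSet E)
    (hEc : E ⊆ coneSet g J c) : volume (g '' E) ≤ ENNReal.ofReal c * volume E := by
  have hmeas (n : ℕ) := measurableSet_lowerConeSet hJ hg c (1 / (n + 1))
  have hmeas' (n : ℕ) := measurableSet_lowerConeSet (g := fun t => -g t) hJ hg.neg c (1 / (n + 1))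
  let B := ⋃ n : ℕ, lowerConeSet g J c (1 / (n + 1))
  have hB : MeasurableSet B := .iUnion hmeas
  have h1 : volume (g '' (E ∩ B)) ≤ ENNReal.ofReal c * volume (E ∩ B) :=
    volume_image_le_of_subset_iUnion (hE.inter hB) hmeas inter_subset_right fun n F hF hFm =>
      volume_image_le_of_lipschitz_of_dist_lt hFm Nat.one_div_pos_of_nat fun x hx y hy =>
        abs_sub_le_of_mem_lowerConeSet (hF hx) (hF hy)
  have h2 : volume (g '' (E \ B)) ≤ ENNReal.ofReal c * volume (E \ B) := by
    refine volume_image_le_of_subset_iUnion (hE.diff hB) hmeas'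
      (fun x hx => (hEc hx.1).resolve_left hx.2) fun n F hF hFm =>
      volume_image_le_of_lipschitz_of_dist_lt hFm (Nat.one_div_pos_of_nat (n := n))
        fun x hx y hy hxy => ?_
    have := abs_sub_le_of_mem_lowerConeSet (hF hx) (hF hy) hxy
    rwa [neg_sub_neg, abs_sub_comm] at this
  calc volume (g '' E) = volume (g '' (E ∩ B) ∪ g '' (E \ B)) := by
        rw [← image_union, inter_union_sdiff]
    _ ≤ _ := (measure_union_le _ _).trans (add_le_add h1 h2)
    _ = ENNReal.ofReal c * volume E := by rw [← mul_add, measure_inter_add_sdiff E hB]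

/-- The mean value inequality up to an error `ε`, from the partition of `E` into the layers
`coneSet g J ((k + 1) * ε) \ coneSet g J (k * ε)` (nothing is removed for `k = 0`), on which
`k * ε ≤ h`. The layers are measurable
even if `h` is not, which is what makes the lower integral of `h` sufficient. -/
lemma volume_image_le_lintegral_add {g h : ℝ → ℝ} {J : Set ℝ} (hJ : MeasurableSet J)
    (hg : Measurable (J.domRestrict g)) {E : Set ℝ} (hE : MeasurableSet E)
    (hh0 : ∀ t ∈ E, 0 ≤ h t) (hh : ∀ t ∈ E, ∀ c, h t < c → t ∈ coneSet g J c)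
    {ε : ℝ} (hε : 0 < ε) :
    volume (g '' E) ≤ (∫⁻ t in E, ENNReal.ofReal (h t)) + ENNReal.ofReal ε * volume E := by
  let A : ℕ → Set ℝ := fun k => coneSet g J ((k + 1) * ε)
  have hA (k : ℕ) : MeasurableSet (A k) := measurableSet_coneSet hJ hg _
  have hm (k : ℕ) : MeasurableSet (E ∩ disjointed A k) := hE.inter (.disjointed hA k)
  have hEA : E ⊆ ⋃ k, A k := fun t ht => by
    obtain ⟨k, hk⟩ := exists_nat_gt (h t / ε)
    refine mem_iUnion.2 ⟨k, hh t ht _ ?_⟩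
    rw [div_lt_iff₀ hε] at hk
    linarith
  have hU : ⋃ k, E ∩ disjointed A k = E := by
    rw [← inter_iUnion, iUnion_disjointed, inter_eq_left.2 hEA]
  have hd : Pairwise (Function.onFun Disjoint fun k => E ∩ disjointed A k) := fun i j hij =>
    (disjoint_disjointed A hij).mono inter_subset_right inter_subset_right
  have hle (k : ℕ) : ∀ t ∈ E ∩ disjointed A k, k * ε ≤ h t := by
    rintro t ⟨htE, htA⟩
    by_contra! hlt
    cases k with
    | zero => exact absurd (hh0 t htE) (by simpa using hlt)
    | succ j =>
      rw [disjointed_eq_inter_compl] at htA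
      exact mem_iInter₂.1 htA.2 j j.lt_succ_self (hh t htE _ (by simpa using hlt))
  have hk (k : ℕ) : volume (g '' (E ∩ disjointed A k)) ≤
      (∫⁻ t in E ∩ disjointed A k, ENNReal.ofReal (h t)) +
        ENNReal.ofReal ε * volume (E ∩ disjointed A k) := by
    have h1 := volume_image_le_of_subset_coneSet hJ hg (hm k)
      (inter_subset_right.trans (disjointed_subset A k))
    have h2 : ENNReal.ofReal (k * ε) * volume (E ∩ disjointed A k) ≤
        ∫⁻ t in E ∩ disjointed A k, ENNReal.ofReal (h t) := by
      rw [← setLIntegral_const]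
      exact setLIntegral_mono' (hm k) fun t ht => ENNReal.ofReal_le_ofReal (hle k t ht)
    rw [add_mul, one_mul, ENNReal.ofReal_add (by positivity) hε.le, add_mul] at h1
    exact h1.trans (add_le_add_left h2 _)
  calc volume (g '' E) = volume (⋃ k, g '' (E ∩ disjointed A k)) := by rw [← image_iUnion, hU]
    _ ≤ ∑' k, volume (g '' (E ∩ disjointed A k)) := measure_iUnion_le _
    _ ≤ ∑' k, _ := ENNReal.tsum_le_tsum hk
    _ = _ := by
      rw [ENNReal.tsum_add, ENNReal.tsum_mul_left, ← measure_iUnion hd hm,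
        ← lintegral_iUnion hm hd, hU]

/-- The mean value inequality on the line, for a function `g` that satisfies, outside a countable
set, a cone condition of every slope larger than `h` at each point. -/
lemma volume_image_le_lintegral {g h : ℝ → ℝ} {J N : Set ℝ} (hJ : MeasurableSet J)
    (hg : Measurable (J.domRestrict g)) (hN : N.Countable) (hh0 : ∀ t ∈ J, 0 ≤ h t)
    (hh : ∀ t ∈ J \ N, ∀ c, h t < c → t ∈ coneSet g J c) :
    volume (g '' J) ≤ ∫⁻ t in J, ENNReal.ofReal (h t) := by
  let P : ℤ → Set ℝ := fun m => (J \ N) ∩ {t | ⌊t⌋ = m}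
  have hPm (m : ℤ) : MeasurableSet (P m) :=
    (hJ.diff hN.measurableSet).inter (Int.measurable_floor (measurableSet_singleton m))
  have hPU : ⋃ m, P m = J \ N := by ext t; simp [P]
  have hPd : Pairwise (Function.onFun Disjoint P) := by
    intro i j hij
    exact Set.disjoint_left.2 fun t hi hj => hij (hi.2.symm.trans hj.2)
  have hP (m : ℤ) : volume (g '' P m) ≤ ∫⁻ t in P m, ENNReal.ofReal (h t) := by
    have hfin : volume (P m) ≤ 1 := by
      have : P m ⊆ Ico (m : ℝ) (m + 1) := fun t ht => Int.floor_eq_iff.1 ht.2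
      simpa using measure_mono (μ := volume) this
    refine ENNReal.le_of_forall_pos_le_add fun ε hε _ => ?_
    refine (volume_image_le_lintegral_add hJ hg (hPm m) (fun t ht => hh0 t ht.1.1)
      (fun t ht => hh t ht.1) (ε := ε) hε).trans (add_le_add_right ?_ _)
    simpa using mul_le_mul_right hfin (ε : ℝ≥0∞)
  have hnull : volume (g '' (J ∩ N)) = 0 :=
    ((hN.mono inter_subset_right).image g).measure_zero _
  calc volume (g '' J) = volume (g '' (J ∩ N) ∪ ⋃ m, g '' P m) := by
        rw [← image_iUnion, hPU, ← image_union, inter_union_sdiff]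
    _ ≤ volume (g '' (J ∩ N)) + volume (⋃ m, g '' P m) := measure_union_le _ _
    _ = volume (⋃ m, g '' P m) := by rw [hnull, zero_add]
    _ ≤ ∑' m, volume (g '' P m) := measure_iUnion_le _
    _ ≤ ∑' m, ∫⁻ t in P m, ENNReal.ofReal (h t) := ENNReal.tsum_le_tsum hP
    _ = ∫⁻ t in J \ N, ENNReal.ofReal (h t) := by rw [← lintegral_iUnion hPm hPd, hPU]
    _ ≤ ∫⁻ t in J, ENNReal.ofReal (h t) := lintegral_mono_set sdiff_subset

/-- A function that touches `g` from below at `t`, with derivative less than `c` in absolute value,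
puts `t` in a lower cone set of slope `c`. -/
lemma mem_iUnion_lowerConeSet {g u : ℝ → ℝ} {J : Set ℝ} {t u' c : ℝ} (ht : t ∈ J)
    (hu : HasDerivAt u u' t) (hc : |u'| < c) (hmin : IsLocalMin (fun s => g s - u s) t) :
    t ∈ ⋃ n : ℕ, lowerConeSet g J c (1 / (n + 1)) := by
  have h1 : ∀ᶠ s in 𝓝 t, ‖u s - u t - (s - t) • u'‖ ≤ (c - |u'|) * ‖s - t‖ :=
    hu.isLittleO.bound (sub_pos.2 hc)
  obtain ⟨r, hr, h2⟩ := Metric.eventually_nhds_iff.1 (h1.and hmin)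
  obtain ⟨n, hn⟩ := exists_nat_one_div_lt hr
  refine mem_iUnion.2 ⟨n, ht, fun s _ hs => ?_⟩
  obtain ⟨h3, h4⟩ := h2 (y := s) (by rw [Real.dist_eq]; exact hs.trans hn)
  simp only [Real.norm_eq_abs, smul_eq_mul] at h3
  have h5 := abs_le.1 h3
  have h6 := abs_le.1 (abs_mul (s - t) u').le
  nlinarith

/-! ### Paths parameterized by arc length -/

section

variable {H : Type*} [NormedAddCommGroup H] [InnerProductSpace ℝ H]
  {M : Type*} [TopologicalSpace M] [ChartedSpace H M]
  [RiemannianBundle (fun x : M => TangentSpace 𝓘(ℝ, H) x)]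

/-- The chain rule along a path of speed one: the derivative of `φ ∘ γ` is the value of `dφ` at a
unit vector. -/
lemma exists_hasDerivAt_comp_of_norm_mfderivWithin_eq_one {γ : ℝ → M} {φ : M → ℝ} {a b t : ℝ}
    (ht : t ∈ Ioo a b) (hγ : ContMDiffOn 𝓘(ℝ, ℝ) 𝓘(ℝ, H) 1 γ (Icc a b))
    (hγ' : ‖(mfderivWithin 𝓘(ℝ, ℝ) 𝓘(ℝ, H) γ (Icc a b) t (1 : ℝ) :
          TangentSpace 𝓘(ℝ, H) (γ t))‖ = 1)
    (hφ : ContMDiff 𝓘(ℝ, H) 𝓘(ℝ, ℝ) 1 φ) {ζ : TangentSpace 𝓘(ℝ, H) (γ t) →L[ℝ] ℝ}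
    (hζ : ζ = mfderiv 𝓘(ℝ, H) 𝓘(ℝ, ℝ) φ (γ t)) :
    ∃ u', HasDerivAt (fun s => φ (γ s)) u' t ∧ |u'| ≤ ‖ζ‖ := by
  set v : TangentSpace 𝓘(ℝ, H) (γ t) := mfderivWithin 𝓘(ℝ, ℝ) 𝓘(ℝ, H) γ (Icc a b) t (1 : ℝ)
    with hv
  have h1 := ((hγ t (Ioo_subset_Icc_self ht)).mdifferentiableWithinAt
    one_ne_zero).hasMFDerivWithinAt
  have h2 := ((hφ (γ t)).mdifferentiableAt one_ne_zero).hasMFDerivAt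
  have h3 := (h2.comp_hasMFDerivWithinAt t h1).hasFDerivWithinAt
  obtain ⟨L, hL, hLv⟩ : ∃ L : ℝ →L[ℝ] ℝ,
      HasFDerivWithinAt (fun s => φ (γ s)) L (Icc a b) t ∧ L 1 = ζ v :=
    ⟨_, h3, by rw [hζ, hv]; rfl⟩
  have h4 : HasDerivWithinAt (fun s => φ (γ s)) (ζ v) (Icc a b) t := by
    rw [← hLv]
    exact hL.hasDerivWithinAt
  refine ⟨ζ v, h4.hasDerivAt (Icc_mem_nhds ht.1 ht.2), ?_⟩
  have h5 := ζ.le_opNorm v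
  rwa [hγ', mul_one] at h5

variable [IsManifold 𝓘(ℝ, H) ∞ M]

/-- Away from the end points of `J` and the break points, a path parameterized by arc length is
`C¹` with velocity of norm one on a neighbourhood. -/
lemma IsArcLengthPath.exists_countable {γ : ℝ → M} {J : Set ℝ} (hJ : J.OrdConnected)
    (hγ : IsArcLengthPath H γ J) : ∃ N : Set ℝ, N.Countable ∧ ∀ t ∈ J \ N, ∃ c d,
      Icc c d ⊆ J ∧ t ∈ Ioo c d ∧ ContMDiffOn 𝓘(ℝ, ℝ) 𝓘(ℝ, H) 1 γ (Icc c d) ∧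
      ‖(mfderivWithin 𝓘(ℝ, ℝ) 𝓘(ℝ, H) γ (Icc c d) t (1 : ℝ) :
          TangentSpace 𝓘(ℝ, H) (γ t))‖ = 1 := by
  obtain ⟨S, hS, hpw⟩ := hγ.piecewise
  -- The countable exceptional set: the end points of `J`, and the break points that lie between
  -- two points of `J`; countability of the latter is checked on rational subintervals.
  refine ⟨{t | t ∈ J ∧ ∀ c ∈ J, t ≤ c} ∪ {t | t ∈ J ∧ ∀ c ∈ J, c ≤ t} ∪
    ⋃ p : ℚ × ℚ, {t | (p.1 : ℝ) ∈ J ∧ (p.2 : ℝ) ∈ J ∧ t ∈ S ∩ Icc (p.1 : ℝ) p.2}, ?_, ?_⟩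
  · refine .union (.union (Set.Subsingleton.countable ?_) (Set.Subsingleton.countable ?_))
      (countable_iUnion fun p => ?_)
    · exact fun x hx y hy => le_antisymm (hx.2 y hy.1) (hy.2 x hx.1)
    · exact fun x hx y hy => le_antisymm (hy.2 x hx.1) (hx.2 y hy.1)
    · by_cases hp : (p.1 : ℝ) ∈ J ∧ (p.2 : ℝ) ∈ J
      · exact (hS _ hp.1 _ hp.2).countable.mono fun t ht => ht.2.2
      · exact countable_empty.mono fun t ht => hp ⟨ht.1, ht.2.1⟩
  · rintro t ⟨htJ, htN⟩
    simp only [mem_union, not_or, mem_ofPred_eq, not_and, not_forall, not_le, mem_iUnion,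
      not_exists] at htN
    obtain ⟨⟨hl, hr⟩, htS⟩ := htN
    obtain ⟨a, haJ, hat⟩ := hl htJ
    obtain ⟨b, hbJ, htb⟩ := hr htJ
    obtain ⟨a', ha1, ha2⟩ := exists_rat_btwn hat
    obtain ⟨b', hb1, hb2⟩ := exists_rat_btwn htb
    have ha'J : (a' : ℝ) ∈ J := hJ.out haJ hbJ ⟨ha1.le, (ha2.trans htb).le⟩
    have hb'J : (b' : ℝ) ∈ J := hJ.out haJ hbJ ⟨(hat.trans hb1).le, hb2.le⟩
    have htF : t ∉ S ∩ Icc (a' : ℝ) b' := htS (a', b') ha'J hb'J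
    have hnhds : Ioo (a' : ℝ) b' \ (S ∩ Icc (a' : ℝ) b') ∈ 𝓝 t :=
      (isOpen_Ioo.sdiff (hS _ ha'J _ hb'J).isClosed).mem_nhds ⟨⟨ha2, hb1⟩, htF⟩
    obtain ⟨r, hr, hball⟩ := Metric.nhds_basis_closedBall.mem_iff.1 hnhds
    rw [Real.closedBall_eq_Icc] at hball
    have hsub : Icc (t - r) (t + r) ⊆ J := fun s hs =>
      hJ.out ha'J hb'J (Ioo_subset_Icc_self (hball hs).1)
    have hdisj : Disjoint S (Ioo (t - r) (t + r)) := Set.disjoint_right.2 fun s hs hsS =>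
      (hball (Ioo_subset_Icc_self hs)).2
        ⟨hsS, Ioo_subset_Icc_self (hball (Ioo_subset_Icc_self hs)).1⟩
    obtain ⟨h1, h2⟩ := hpw _ (hsub (left_mem_Icc.2 (by linarith))) _
      (hsub (right_mem_Icc.2 (by linarith))) (by linarith) hdisj
    exact ⟨t - r, t + r, hsub, ⟨by linarith, by linarith⟩, h1,
      h2 t ⟨by linarith, by linarith⟩⟩

/-- Sub- and superdifferentiability of `f` along the path become the cone conditions for
`f ∘ γ`, with any slope larger than the minimal subgradient norm. -/
lemma mem_coneSet_of_minSubgradientNorm_lt {f : M → ℝ} {γ : ℝ → M} {J : Set ℝ} {a b t c : ℝ}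
    (hne : (viscositySubdifferential (H := H) f (γ t) ∪
      viscositySuperdifferential (H := H) f (γ t)).Nonempty)
    (hJ : Icc a b ⊆ J) (ht : t ∈ Ioo a b)
    (hγ : ContMDiffOn 𝓘(ℝ, ℝ) 𝓘(ℝ, H) 1 γ (Icc a b))
    (hγ' : ‖(mfderivWithin 𝓘(ℝ, ℝ) 𝓘(ℝ, H) γ (Icc a b) t (1 : ℝ) :
          TangentSpace 𝓘(ℝ, H) (γ t))‖ = 1)
    (hc : minSubgradientNorm (H := H) f (γ t) < c) :
    t ∈ coneSet (fun s => f (γ s)) J c := by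
  have htJ : t ∈ J := hJ (Ioo_subset_Icc_self ht)
  have hcont : ContinuousAt γ t := hγ.continuousOn.continuousAt (Icc_mem_nhds ht.1 ht.2)
  obtain ⟨_, ⟨ζ, hζ, rfl⟩, hlt : ‖ζ‖ < c⟩ := exists_lt_of_csInf_lt (hne.image _) hc
  rcases hζ with ⟨φ, hφ, hm, hφζ⟩ | ⟨φ, hφ, hm, hφζ⟩
  · obtain ⟨u', hu, hle⟩ := exists_hasDerivAt_comp_of_norm_mfderivWithin_eq_one ht hγ hγ' hφ hφζ
    exact .inl (mem_iUnion_lowerConeSet htJ hu (hle.trans_lt hlt) (hcont.eventually hm))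
  · obtain ⟨u', hu, hle⟩ := exists_hasDerivAt_comp_of_norm_mfderivWithin_eq_one ht hγ hγ' hφ hφζ
    refine .inr (mem_iUnion_lowerConeSet htJ hu.neg (by rw [abs_neg]; exact hle.trans_lt hlt) ?_)
    filter_upwards [hcont.eventually hm] with s hs
    simp only [Pi.neg_apply]
    linarith

end

theorem mainTheorem8
    {H : Type*} [NormedAddCommGroup H] [InnerProductSpace ℝ H] [CompleteSpace H]
    {M : Type*} [TopologicalSpace M] [ChartedSpace H M] [IsManifold 𝓘(ℝ, H) ∞ M]
    [RiemannianBundle (fun x : M => TangentSpace 𝓘(ℝ, H) x)]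
    [IsContMDiffRiemannianBundle 𝓘(ℝ, H) ∞ H (fun x : M => TangentSpace 𝓘(ℝ, H) x)]
    [MeasurableSpace M] [BorelSpace M]
    (f : M → ℝ) (hf : Measurable f)
    (hne : ∀ p : M, (viscositySubdifferential (H := H) f p ∪
      viscositySuperdifferential (H := H) f p).Nonempty)
    (J : Set ℝ) (hJ : J.OrdConnected)
    (γ : ℝ → M) (hγ : IsArcLengthPath H γ J) :
    volume (f '' (γ '' J)) ≤
      ∫⁻ t in J, ENNReal.ofReal (minSubgradientNorm (H := H) f (γ t)) := by
  obtain ⟨N, hN, hNγ⟩ := hγ.exists_countable hJ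
  have hg : Measurable (J.domRestrict fun t => f (γ t)) :=
    hf.comp hγ.continuousOn.domRestrict.measurable
  rw [image_image]
  refine volume_image_le_lintegral hJ.measurableSet hg hN ?_ fun t ht c hc => ?_
  · rintro t -
    exact Real.sInf_nonneg (by rintro _ ⟨ζ, -, rfl⟩; exact norm_nonneg ζ)
  · obtain ⟨a, b, hsub, htab, hC, hC'⟩ := hNγ t ht
    exact mem_coneSet_of_minSubgradientNorm_lt (hne (γ t)) hsub htab hC hC' hc
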